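/- Let $\Gamma\subset PSL(2,\mathbb R)$ be a discrete subgroup (a Fuchsian group), $M=\mathbb H^2/\Gamma$ with its hyperbolic metric, and let $H$ be a closed geodesic of $M$ of length $\ell$, the projection of a unit-speed geodesic $c:\mathbb R\to\mathbb H^2$ with $\gamma(c(s))=c(s+\ell)$ for some $\gamma\in\Gamma$ and all $s$; the image $\mathrm{Axis}(\gamma)=c(\mathbb R)$ is the axis of $\gamma$. Let $G^t$ be the geodesic flow on the unit cotangent bundle $S^*M$, let $S^*_HM$ be the set of unit covectors with footpoint on $H$, let $r_H$ be the reflection of $S^*_HM$ through $T^*H$ (it keeps the tangential component of a covector and reverses the normal one), for an integer $j\neq0$ let $T^{(j)}(v)$ be the $j$-th return time of the geodesic generated by $v\in S^*_HM$ to $H$ (in the backward direction if $j<0$), and let $\mu_{L,H}=|ds\wedge d\sigma|$ be the Liouville measure on $S^*_HM$, where $s$ is arc length along $H$ and $\sigma=\cos\theta$ is the tangential component of a unit covector that makes the angle $\theta$ with $H$. Suppose that $H$ has a positive measure of microlocal reflection symmetry, i.e. $$\mu_{L,H}\Big(\bigcup_{j\neq0}\{v\in S^*_HM:\ r_H\,G^{T^{(j)}(v)}v=G^{T^{(j)}(v)}\,r_H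 v\}\Big)>0 .$$ Then there exist an orientation-reversing isometric involution $\epsilon$ of $\mathbb H^2$ that fixes every point of $\mathrm{Axis}(\gamma)$, and elements $\sigma_+,\sigma_-\in\Gamma$ with $\sigma_-=\epsilon\,\sigma_+\,\epsilon$, such that $\langle\gamma,\sigma_+,\sigma_-\rangle\subset\Gamma$ is a three-generator subgroup, i.e. it is generated by these three elements and by no fewer than three elements. -/

import Mathlib

open UpperHalfPlane MeasureTheory
open scoped MatrixGroups

noncomputable section

namespace HypSurface

/-- The action of `SL(2,ℝ)` on the hyperbolic plane by Möbius transformations. Its range is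
`PSL(2,ℝ)`, the group of orientation-preserving isometries of `ℍ`. -/
def mobius : SL(2, ℝ) →* (ℍ ≃ᵢ ℍ) where
  toFun g := IsometryEquiv.constSMul g
  map_one' := by ext z; simp
  map_mul' g h := by ext z; simp [mul_smul]

/-- An isometry of `ℍ` reverses the orientation when it is not in `PSL(2,ℝ)`. -/
def OrientationReversing (φ : ℍ ≃ᵢ ℍ) : Prop := φ ∉ mobius.range

/-- A Fuchsian group: a discrete subgroup of `PSL(2,ℝ)`, i.e. the image in `PSL(2,ℝ)` of a
discrete subgroup of `SL(2,ℝ)`. -/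
def IsFuchsian (Γ : Subgroup (ℍ ≃ᵢ ℍ)) : Prop :=
  ∃ Γ' : Subgroup SL(2, ℝ), DiscreteTopology Γ' ∧ Γ = Γ'.map mobius

/-- The unit (co)tangent bundle `S*ℍ`. A unit covector at `z` is identified (through the metric)
with a unit tangent vector at `z`, and this with the complete unit-speed geodesic `c : ℝ → ℍ`,
`c 0 = z`, that it generates. In `ℍ` these are exactly the isometric embeddings of the line. -/
def UnitVector : Type := {c : ℝ → ℍ // Isometry c}

namespace UnitVector

instance : CoeFun UnitVector (fun _ => ℝ → ℍ) := ⟨Subtype.val⟩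

/-- The footpoint. -/
def foot (v : UnitVector) : ℍ := v 0

/-- The tangent vector itself, as a complex number (`T_z ℍ = ℂ`). -/
def dir (v : UnitVector) : ℂ := deriv (fun u : ℝ => ((v u : ℍ) : ℂ)) 0

/-- The geodesic flow `G^t`. -/
def flow (t : ℝ) (v : UnitVector) : UnitVector :=
  ⟨fun u => v (t + u), v.2.comp (isometry_add_left t)⟩

/-- Isometries act on unit vectors (by their differentials, that is, by carrying geodesics to
geodesics). -/
instance : MulAction (ℍ ≃ᵢ ℍ) UnitVector where
  smul g v := ⟨fun u => g (v u), g.isometry.comp v.2⟩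
  one_smul _ := rfl
  mul_smul _ _ _ := rfl

/-- `w` is the image of `v` under the reflection of the tangent plane in the line spanned by
`τ`: all three have the same footpoint, `w` and `v` have the same component along `τ` and
opposite components normal to `τ`. (The metric of `ℍ` is conformal to the Euclidean one.) -/
def IsReflection (τ v w : UnitVector) : Prop :=
  v.foot = τ.foot ∧ w.foot = τ.foot ∧ w.dir / τ.dir = (starRingEnd ℂ) (v.dir / τ.dir)

/-- `v` is the unit vector `ξ(s, θ)` with footpoint `c s` that makes the angle `θ` with the
velocity vector of `c` at `c s`. -/
def IsAtAngle (c : UnitVector) (s θ : ℝ) (v : UnitVector) : Prop :=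
  v.foot = c s ∧ v.dir = Complex.exp (θ * Complex.I) * (flow s c).dir

end UnitVector

open UnitVector

/-- The unit cotangent bundle `S*M` of `M = ℍ/Γ`. -/
abbrev UnitBundle (Γ : Subgroup (ℍ ≃ᵢ ℍ)) : Type := MulAction.orbitRel.Quotient Γ UnitVector

/-- The projection `S*ℍ → S*M`. -/
def proj (Γ : Subgroup (ℍ ≃ᵢ ℍ)) (v : UnitVector) : UnitBundle Γ :=
  Quotient.mk (MulAction.orbitRel Γ UnitVector) v

/-- The geodesic `c` of `ℍ` projects to a closed geodesic of `ℍ/Γ` of length `ℓ`, and `γ ∈ Γ` is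
the corresponding element: it translates its axis, the image of `c`, by `ℓ`. -/
structure IsClosedGeodesic (Γ : Subgroup (ℍ ≃ᵢ ℍ)) (γ : ℍ ≃ᵢ ℍ) (c : UnitVector) (ℓ : ℝ) :
    Prop where
  mem : γ ∈ Γ
  length_pos : 0 < ℓ
  translate : ∀ s : ℝ, γ (c s) = c (s + ℓ)

/-- The preimage in `ℍ` of the curve `H ⊂ ℍ/Γ` that is the projection of `c`: the union of all
translates of the image of `c` by elements of `Γ`. -/
def liftedCurve (Γ : Subgroup (ℍ ≃ᵢ ℍ)) (c : UnitVector) : Set ℍ :=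
  {z | ∃ σ ∈ Γ, ∃ u : ℝ, z = σ (c u)}

/-- The times at which the geodesic in `ℍ/Γ` generated by `v` is on `H`. -/
def hitTimes (Γ : Subgroup (ℍ ≃ᵢ ℍ)) (c v : UnitVector) : Set ℝ :=
  {t | (flow t v).foot ∈ liftedCurve Γ c}

/-- `t = T^{(j)}(v)` is the `j`-th return time of `v` to `H`: for `j > 0` it is the `j`-th
positive time at which the geodesic is on `H`; for `j < 0` it is the `|j|`-th such time in the
backward direction. -/
def IsReturnTime (Γ : Subgroup (ℍ ≃ᵢ ℍ)) (c v : UnitVector) (j : ℤ) (t : ℝ) : Prop :=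
  t ∈ hitTimes Γ c v ∧
    ((0 < j ∧ 0 < t ∧ (hitTimes Γ c v ∩ Set.Ioc 0 t).encard = j.natAbs) ∨
     (j < 0 ∧ t < 0 ∧ (hitTimes Γ c v ∩ Set.Ico t 0).encard = j.natAbs))

/-- The equation `r_H G^t v = G^t r_H v` in `S*M`, for a unit vector `v` with footpoint on the
geodesic `c` at `c s` and a time `t` at which `G^t v` has its footpoint on `H` again. Here `w` is
`r_H v`, and `f` is `r_H (G^t v)`, the reflection in the tangent line at the point where the
geodesic generated by `v` hits a component `σ c` of the lift of `H`. -/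
def ReflectionCommutes (Γ : Subgroup (ℍ ≃ᵢ ℍ)) (c : UnitVector) (s : ℝ) (v : UnitVector)
    (t : ℝ) : Prop :=
  ∃ w : UnitVector, IsReflection (flow s c) v w ∧
    ∃ σ ∈ Γ, ∃ u : ℝ, ∃ f : UnitVector,
      IsReflection (σ • flow u c) (flow t v) f ∧ proj Γ f = proj Γ (flow t w)

/-- The set of microlocal reflection symmetry
`⋃_{j ≠ 0} {v ∈ S*_H M : r_H G^{T^{(j)}(v)} v = G^{T^{(j)}(v)} r_H v}`, in the coordinates
`(s, θ)` on `S*_H M`: `s` is arc length along the closed geodesic, `θ` the angle with it. -/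
def symmetrySet (Γ : Subgroup (ℍ ≃ᵢ ℍ)) (c : UnitVector) : Set (ℝ × ℝ) :=
  ⋃ j : {j : ℤ // j ≠ 0}, {p | ∃ v : UnitVector, IsAtAngle c p.1 p.2 v ∧
    ∃ t : ℝ, IsReturnTime Γ c v j t ∧ ReflectionCommutes Γ c p.1 v t}

/-- The Liouville measure `|ds ∧ dσ|`, `σ = cos θ`, of `S*_H M` for a closed geodesic `H` of
length `ℓ`, in the coordinates `0 ≤ s < ℓ`, `0 ≤ θ < 2π`. -/
def liouvilleMeasure (ℓ : ℝ) : Measure (ℝ × ℝ) :=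
  (volume.restrict (Set.Ico 0 ℓ ×ˢ Set.Ico 0 (2 * Real.pi))).withDensity
    (fun p => ENNReal.ofReal |Real.sin p.2|)

/-- The closed geodesic of length `ℓ` covered by `c` has a positive measure of microlocal
(reflection) symmetry. -/
def HasPositiveMicrolocalSymmetry (Γ : Subgroup (ℍ ≃ᵢ ℍ)) (c : UnitVector) (ℓ : ℝ) : Prop :=
  0 < liouvilleMeasure ℓ (symmetrySet Γ c)

end HypSurface

end

noncomputable section

namespace HypSurface

open UnitVector Filter Topology

/-! The measure hypothesis serves to produce one vector: `sin θ = 0` is Liouville-null, so some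
symmetric `v` is transversal to the axis. Let `ε` be the reflection in the axis, and let `v` return
to `H` on the component `σ(Axis)`, `σ ∈ Γ`. Lifted to `ℍ`, the commutation relation says that `δ ε`
and `σ ε σ⁻¹`, for some `δ ∈ Γ`, send `G^t v` to the same vector. Both reverse orientation, and such
an isometry is determined by its value on one unit vector, so they agree and `ε σ ε = δ⁻¹ σ ∈ Γ`.
Transversality makes `σ` move the axis (`exists_conj_mem_of_symmetry`).

In coordinates where the axis is imaginary, `γ` is a dilation `D`, and discreteness keeps `σ`, with
matrix `S`, from sending an end point of the axis to an end point
(`SequentiallyDiscrete.apply_ne_zero`). For large `N` the map `h = S D^N S` squeezes the complement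
of an annulus around `|z| = |S⁻¹ 0|` into a small disc around `S ∞`. Ping-pong then makes `D`, `h D
h⁻¹` and the mirror image of the latter free generators (`exists_injective_lift_dilation`).
Conjugating by `h`, rather than passing to powers, keeps `γ` itself among them.

Since `ε` commutes with `γ`, the element `τ = σ γ^N σ` and its mirror image both lie in `Γ`; take
`σ₊ = τ γ τ⁻¹`. A free group on three generators has rank three, as its map onto `ℤ³ ⊂ ℚ³` shows. -/

/-! ### Unit vectors as Möbius images of the vertical geodesic. -/

lemma coe_mobius (m : SL(2, ℝ)) (z : ℍ) :
    (mobius m z : ℂ) = ((m 0 0 : ℂ) * z + m 0 1) / ((m 1 0 : ℂ) * z + m 1 1) :=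
  coe_specialLinearGroup_apply m z

lemma mobius_denom_ne_zero (m : SL(2, ℝ)) (z : ℍ) : (m 1 0 : ℂ) * z + m 1 1 ≠ 0 :=
  denom_ne_zero (m : GL (Fin 2) ℝ) z

lemma SL2_det_eq_one (m : SL(2, ℝ)) : m 0 0 * m 1 1 - m 0 1 * m 1 0 = 1 := by
  rw [← Matrix.det_fin_two, m.2]

/-- The geodesic `s ↦ i e ^ s`. -/
def imaginaryAxis : UnitVector := ⟨_, isometry_vertical_line 0⟩

lemma coe_imaginaryAxis (s : ℝ) : (imaginaryAxis s : ℂ) = Real.exp s * Complex.I := by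
  apply Complex.ext <;> simp [imaginaryAxis, -Complex.ofReal_exp]

lemma smul_unitVector_apply (g : ℍ ≃ᵢ ℍ) (v : UnitVector) (u : ℝ) : (g • v) u = g (v u) := rfl

lemma flow_apply (t u : ℝ) (v : UnitVector) : flow t v u = v (t + u) := rfl

lemma foot_eq (v : UnitVector) : v.foot = v 0 := rfl

lemma UnitVector.ext {v w : UnitVector} (h : ∀ u, v u = w u) : v = w := Subtype.ext (funext h)

lemma smul_flow (g : ℍ ≃ᵢ ℍ) (t : ℝ) (v : UnitVector) : g • flow t v = flow t (g • v) := rfl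

lemma dist_unitVector (v : UnitVector) (s t : ℝ) : dist (v s) (v t) = |s - t| := by
  rw [v.2.dist_eq, Real.dist_eq]

lemma cosh_dist_imaginaryAxis (z : ℍ) (s : ℝ) :
    2 * z.im * Real.exp s * Real.cosh (dist z (imaginaryAxis s)) =
      z.re ^ 2 + z.im ^ 2 + Real.exp s ^ 2 := by
  have h1 : (imaginaryAxis s).re = 0 := rfl
  have h2 : (imaginaryAxis s).im = Real.exp s := rfl
  have := z.im_pos
  have := Real.exp_pos s
  rw [cosh_dist', h1, h2]
  field_simp
  ring

lemma eq_imaginaryAxis_of_two_points {v : UnitVector} {t : ℝ} (ht : t ≠ 0)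
    (h0 : v 0 = imaginaryAxis 0) (h1 : v t = imaginaryAxis t) : v = imaginaryAxis := by
  apply UnitVector.ext
  intro u
  have e0 := cosh_dist_imaginaryAxis (v u) 0
  have e1 := cosh_dist_imaginaryAxis (v u) t
  rw [← h0, dist_unitVector, Real.cosh_abs, sub_zero, Real.exp_zero, Real.cosh_eq] at e0
  rw [← h1, dist_unitVector, Real.cosh_abs, Real.cosh_eq, neg_sub, Real.exp_sub, Real.exp_sub] at e1
  rw [Real.exp_neg] at e0
  have pu := Real.exp_pos u
  have pt := Real.exp_pos t
  have hne : Real.exp t ^ 2 - 1 ≠ 0 := by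
    intro h
    have : Real.exp t = 1 := by nlinarith
    exact ht (Real.exp_eq_one_iff t |>.1 this)
  field_simp at e0 e1
  -- Subtracting the two distance equations eliminates `|z|²` and leaves a linear equation for the
  -- imaginary part.
  have him : (v u).im = Real.exp u := by
    apply mul_right_cancel₀ hne
    nlinarith
  have hre : (v u).re = 0 := by
    rw [him] at e0
    have : (v u).re ^ 2 * Real.exp u = 0 := by nlinarith
    simpa [pu.ne'] using this
  apply UpperHalfPlane.ext
  apply Complex.ext
  · simpa [imaginaryAxis] using hre
  · simpa [imaginaryAxis] using him

/-- The hypothesis puts `x + iy` at distance `log E` from `i`; `a` and `b` are the entries of a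
rotation about `i` that takes `iE` there. -/
lemma exists_rotation {x y E : ℝ} (hE : 1 < E) (hy : 0 < y)
    (h : x ^ 2 + y ^ 2 + 1 = y * (E + E⁻¹)) :
    ∃ a b : ℝ, a ^ 2 + b ^ 2 = 1 ∧ y * (a ^ 2 + b ^ 2 * E ^ 2) = E ∧
      x * (a ^ 2 + b ^ 2 * E ^ 2) = a * b * (1 - E ^ 2) := by
  have hE0 : 0 < E := by linarith
  have hE2 : 0 < E ^ 2 - 1 := by nlinarith
  have hx : x ^ 2 * E = (E - y) * (y * E - 1) := by
    field_simp at h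
    nlinarith
  have hprod : 0 ≤ (E - y) * (y * E - 1) := by rw [← hx]; positivity
  have h1 : 0 ≤ E - y := by
    by_contra hc
    push Not at hc
    have : 0 < y * E - 1 := by nlinarith
    nlinarith
  have h2 : 0 ≤ y * E - 1 := by
    by_contra hc
    push Not at hc
    have : 0 < E - y := by nlinarith
    nlinarith
  -- `A = a²` and `B = b²` solve the two linear equations. The third relation then holds after
  -- squaring, and the sign of `b` is free to adjust it.
  set A := E * (y * E - 1) / (y * (E ^ 2 - 1)) with hA
  set B := (E - y) / (y * (E ^ 2 - 1)) with hB
  have hA0 : 0 ≤ A := by positivity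
  have hB0 : 0 ≤ B := by positivity
  have hAB : A + B = 1 := by rw [hA, hB]; field_simp; ring
  have hABE : y * (A + B * E ^ 2) = E := by rw [hA, hB]; field_simp; ring
  have hsq : (√A * √B * (1 - E ^ 2)) ^ 2 = (x * (A + B * E ^ 2)) ^ 2 := by
    rw [mul_pow, mul_pow, Real.sq_sqrt hA0, Real.sq_sqrt hB0, mul_pow]
    have e1 : A * (E ^ 2 - 1) * y = E * (y * E - 1) := by rw [hA]; field_simp
    have e2 : B * (E ^ 2 - 1) * y = E - y := by rw [hB]; field_simp
    apply mul_right_cancel₀ (pow_ne_zero 2 hy.ne')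
    linear_combination (B * (E ^ 2 - 1) * y) * e1 + (E * (y * E - 1)) * e2 - E * hx
      - x ^ 2 * (y * (A + B * E ^ 2) + E) * hABE
  rcases sq_eq_sq_iff_eq_or_eq_neg.1 hsq with h' | h'
  · exact ⟨√A, √B, by rw [Real.sq_sqrt hA0, Real.sq_sqrt hB0, hAB],
      by rw [Real.sq_sqrt hA0, Real.sq_sqrt hB0, hABE],
      by rw [Real.sq_sqrt hA0, Real.sq_sqrt hB0, h']⟩
  · exact ⟨√A, -√B, by rw [neg_sq, Real.sq_sqrt hA0, Real.sq_sqrt hB0, hAB],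
      by rw [neg_sq, Real.sq_sqrt hA0, Real.sq_sqrt hB0, hABE],
      by rw [neg_sq, Real.sq_sqrt hA0, Real.sq_sqrt hB0]; linarith⟩

/-- Every unit vector is the image of the standard one under a Möbius transformation. -/
lemma exists_mobius_smul_imaginaryAxis (v : UnitVector) :
    ∃ m : SL(2, ℝ), mobius m • imaginaryAxis = v := by
  obtain ⟨n, hn⟩ : ∃ n : SL(2, ℝ), mobius n (imaginaryAxis 0) = v 0 :=
    MulAction.exists_smul_eq SL(2, ℝ) (imaginaryAxis 0) (v 0)
  set w : UnitVector := (mobius n)⁻¹ • v with hw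
  have hw0 : w 0 = imaginaryAxis 0 := by
    rw [hw, smul_unitVector_apply, ← hn, IsometryEquiv.inv_apply_self]
  have e0 := cosh_dist_imaginaryAxis (w 1) 0
  rw [← hw0, dist_unitVector, Real.cosh_abs, sub_zero, Real.exp_zero, Real.cosh_eq,
    Real.exp_neg] at e0
  obtain ⟨a, b, hab, h1, h2⟩ := exists_rotation (x := (w 1).re) (y := (w 1).im)
    (E := Real.exp 1) (by simp) (w 1).im_pos (by linarith)
  let k : SL(2, ℝ) := ⟨!![a, b; -b, a], by rw [Matrix.det_fin_two_of]; linarith⟩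
  have hk0 : mobius k (imaginaryAxis 0) = imaginaryAxis 0 := by
    apply UpperHalfPlane.ext
    rw [coe_mobius, div_eq_iff (mobius_denom_ne_zero _ _), coe_imaginaryAxis]
    apply Complex.ext <;> simp [k]
  have hk1 : mobius k (imaginaryAxis 1) = w 1 := by
    apply UpperHalfPlane.ext
    have hp := Real.exp_pos 1
    rw [coe_mobius, div_eq_iff (mobius_denom_ne_zero _ _), coe_imaginaryAxis]
    generalize Real.exp 1 = E at h1 h2 hp
    have hD : a ^ 2 + b ^ 2 * E ^ 2 ≠ 0 := by
      intro h; rw [h] at h1; linarith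
    apply Complex.ext
    · simp [k]
      apply mul_right_cancel₀ hD
      linear_combination (-a) * h2 - b * E * h1 + b * (E ^ 2) * hab
    · simp [k]
      apply mul_right_cancel₀ hD
      linear_combination (-a) * h1 + b * E * h2 + a * E * hab
  refine ⟨n * k, ?_⟩
  have hst : (mobius k)⁻¹ • w = imaginaryAxis := by
    apply eq_imaginaryAxis_of_two_points one_ne_zero
    · rw [smul_unitVector_apply, hw0, ← hk0, IsometryEquiv.inv_apply_self, hk0]
    · rw [smul_unitVector_apply, ← hk1, IsometryEquiv.inv_apply_self]
  rw [map_mul, mul_smul, ← hst, smul_inv_smul, hw, smul_inv_smul]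

lemma UnitVector.ext_of_two_points {v w : UnitVector} {s t : ℝ} (hst : s ≠ t)
    (hs : v s = w s) (ht : v t = w t) : v = w := by
  obtain ⟨m, hm⟩ := exists_mobius_smul_imaginaryAxis (flow s w)
  have : (mobius m)⁻¹ • flow s v = imaginaryAxis := by
    apply eq_imaginaryAxis_of_two_points (t := t - s) (by grind)
    · rw [smul_unitVector_apply, flow_apply, add_zero, hs, ← add_zero s, ← flow_apply, ← hm,
        smul_unitVector_apply, IsometryEquiv.inv_apply_self]
    · rw [smul_unitVector_apply, flow_apply, add_sub_cancel, ht]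
      have : w t = flow s w (t - s) := by rw [flow_apply, add_sub_cancel]
      rw [this, ← hm, smul_unitVector_apply, IsometryEquiv.inv_apply_self]
  rw [inv_smul_eq_iff, hm] at this
  apply UnitVector.ext
  intro u
  have h := congrArg (fun x : UnitVector => x (u - s)) this
  simpa [flow_apply] using h

lemma hasDerivAt_imaginaryAxis :
    HasDerivAt (fun u : ℝ => (imaginaryAxis u : ℂ)) Complex.I 0 := by
  have h := ((Real.hasDerivAt_exp 0).ofReal_comp).mul_const Complex.I
  simp only [coe_imaginaryAxis]
  simpa using h

lemma hasDerivAt_mobius_smul (m : SL(2, ℝ)) {v : UnitVector} {d : ℂ}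
    (hv : HasDerivAt (fun u : ℝ => (v u : ℂ)) d 0) :
    HasDerivAt (fun u : ℝ => ((mobius m • v) u : ℂ))
      (d / ((m 1 0 : ℂ) * v 0 + m 1 1) ^ 2) 0 := by
  have hden := mobius_denom_ne_zero m (v 0)
  have hdet : (m 0 0 : ℂ) * m 1 1 - m 0 1 * m 1 0 = 1 := by exact_mod_cast SL2_det_eq_one m
  have h := ((hv.const_mul (m 0 0 : ℂ)).add_const (m 0 1 : ℂ)).fun_div
    ((hv.const_mul (m 1 0 : ℂ)).add_const (m 1 1 : ℂ)) hden
  simp only [smul_unitVector_apply, coe_mobius]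
  convert! h using 1
  field_simp
  linear_combination (-d) * hdet

/-- Isometric embeddings of the line are automatically differentiable, being Möbius images of the
vertical geodesic. -/
lemma hasDerivAt_dir (v : UnitVector) : HasDerivAt (fun u : ℝ => (v u : ℂ)) v.dir 0 := by
  obtain ⟨m, rfl⟩ := exists_mobius_smul_imaginaryAxis v
  exact (hasDerivAt_mobius_smul m hasDerivAt_imaginaryAxis).differentiableAt.hasDerivAt

lemma dir_imaginaryAxis : imaginaryAxis.dir = Complex.I := hasDerivAt_imaginaryAxis.deriv

lemma dir_mobius_smul (m : SL(2, ℝ)) (v : UnitVector) :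
    (mobius m • v).dir = v.dir / ((m 1 0 : ℂ) * v.foot + m 1 1) ^ 2 :=
  (hasDerivAt_mobius_smul m (hasDerivAt_dir v)).deriv

lemma dir_ne_zero (v : UnitVector) : v.dir ≠ 0 := by
  obtain ⟨m, rfl⟩ := exists_mobius_smul_imaginaryAxis v
  rw [dir_mobius_smul, dir_imaginaryAxis]
  exact div_ne_zero Complex.I_ne_zero (pow_ne_zero 2 (mobius_denom_ne_zero _ _))

lemma mobius_neg (m : SL(2, ℝ)) : mobius (-m) = mobius m := by
  apply IsometryEquiv.ext
  intro z
  apply UpperHalfPlane.ext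
  rw [coe_mobius, coe_mobius]
  simp only [Matrix.SpecialLinearGroup.coe_neg, Matrix.neg_apply, Complex.ofReal_neg, neg_mul,
    ← neg_add, neg_div_neg_eq]

/-- A matrix whose Möbius transformation fixes the foot and the direction of the standard vector
is `1` or `-1`. -/
lemma eq_one_or_eq_neg_one_of_fixes {m : SL(2, ℝ)}
    (h0 : (mobius m • imaginaryAxis).foot = imaginaryAxis.foot)
    (h1 : (mobius m • imaginaryAxis).dir = imaginaryAxis.dir) : m = 1 ∨ m = -1 := by
  have hdet := SL2_det_eq_one m
  have h0' : (mobius m (imaginaryAxis 0) : ℂ) = Complex.I := by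
    have := congrArg (fun z : ℍ => (z : ℂ)) h0
    simpa [foot_eq, smul_unitVector_apply, coe_imaginaryAxis] using this
  have hden := mobius_denom_ne_zero m (imaginaryAxis 0)
  rw [coe_mobius, div_eq_iff hden] at h0'
  rw [dir_mobius_smul, dir_imaginaryAxis, foot_eq, div_eq_iff (pow_ne_zero 2 hden)] at h1
  have h1' := mul_left_cancel₀ Complex.I_ne_zero ((mul_one _).trans h1)
  rw [coe_imaginaryAxis] at h0' h1'
  have hc := congrArg Complex.im h1'
  have hd := congrArg Complex.re h1'
  have ha := congrArg Complex.im h0'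
  have hb := congrArg Complex.re h0'
  simp [sq] at ha hb hc hd
  have hc0 : m 1 0 = 0 := by
    have : m 1 0 * m 1 1 = 0 := by linarith
    rcases mul_eq_zero.1 this with h | h
    · exact h
    · rw [h] at hd; nlinarith
  rw [hc0] at hd hb
  have hd' : m 1 1 = 1 ∨ m 1 1 = -1 := by
    apply mul_self_eq_one_iff.1
    linarith
  rcases hd' with h | h
  · left
    ext i j
    fin_cases i <;> fin_cases j <;> simp <;> linarith
  · right
    ext i j
    fin_cases i <;> fin_cases j <;> simp <;> linarith

lemma mobius_eq_one_of_fixes {m : SL(2, ℝ)}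
    (h0 : (mobius m • imaginaryAxis).foot = imaginaryAxis.foot)
    (h1 : (mobius m • imaginaryAxis).dir = imaginaryAxis.dir) : mobius m = 1 := by
  rcases eq_one_or_eq_neg_one_of_fixes h0 h1 with rfl | rfl
  · rw [map_one]
  · rw [mobius_neg, map_one]

lemma eq_or_eq_neg_of_mobius_eq {m n : SL(2, ℝ)} (h : mobius m = mobius n) : m = n ∨ m = -n := by
  have h1 : mobius (m * n⁻¹) = 1 := by rw [map_mul, map_inv, h, mul_inv_cancel]
  have h2 : mobius (m * n⁻¹) • imaginaryAxis = imaginaryAxis := by rw [h1, one_smul]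
  rcases eq_one_or_eq_neg_one_of_fixes (m := m * n⁻¹) (by rw [h2]) (by rw [h2]) with h3 | h3
  · exact Or.inl (mul_inv_eq_one.1 h3)
  · right
    rw [mul_inv_eq_iff_eq_mul] at h3
    rw [h3, neg_mul, one_mul]

lemma mobius_eq_one_of_smul_eq {m : SL(2, ℝ)} {v : UnitVector} (h : mobius m • v = v) :
    mobius m = 1 := by
  obtain ⟨n, rfl⟩ := exists_mobius_smul_imaginaryAxis v
  have : mobius (n⁻¹ * m * n) • imaginaryAxis = imaginaryAxis := by
    rw [map_mul, map_mul, mul_smul, mul_smul, h, map_inv, inv_smul_smul]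
  have h1 : mobius (n⁻¹ * m * n) = 1 := mobius_eq_one_of_fixes (by rw [this]) (by rw [this])
  rw [map_mul, map_mul, map_inv] at h1
  have h2 : mobius m * mobius n = mobius n := by
    rw [mul_assoc, inv_mul_eq_one] at h1; exact h1.symm
  simpa using h2

lemma mobius_smul_dir_div {m : SL(2, ℝ)} {v w : UnitVector} (h : v.foot = w.foot) :
    (mobius m • v).dir / (mobius m • w).dir = v.dir / w.dir := by
  rw [dir_mobius_smul, dir_mobius_smul, h]
  exact div_div_div_cancel_right₀ (pow_ne_zero 2 (mobius_denom_ne_zero _ _)) _ _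

lemma UnitVector.ext_of_dir {v w : UnitVector} (h0 : v.foot = w.foot) (h1 : v.dir = w.dir) :
    v = w := by
  obtain ⟨m, rfl⟩ := exists_mobius_smul_imaginaryAxis v
  obtain ⟨n, rfl⟩ := exists_mobius_smul_imaginaryAxis w
  have e : mobius (n⁻¹ * m) • imaginaryAxis = mobius n⁻¹ • (mobius m • imaginaryAxis) := by
    rw [map_mul, mul_smul]
  have e' : imaginaryAxis = mobius n⁻¹ • (mobius n • imaginaryAxis) := by
    rw [map_inv, inv_smul_smul]
  have key : mobius (n⁻¹ * m) = 1 := by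
    apply mobius_eq_one_of_fixes
    · rw [e]; conv_rhs => rw [e']
      exact congrArg (mobius n⁻¹) h0
    · rw [e]; conv_rhs => rw [e']
      rw [dir_mobius_smul n⁻¹, dir_mobius_smul n⁻¹, h0, h1]
  rw [map_mul, map_inv, inv_mul_eq_one] at key
  rw [key]

/-! ### Reflections in geodesics. -/

/-- The reflection `z ↦ -conj z` in the imaginary axis. -/
def imaginaryReflection : ℍ ≃ᵢ ℍ where
  toEquiv := MulAction.toPerm J
  isometry_toFun := by
    have him : ∀ z : ℍ, (J • z).im = z.im := fun z => by
      rw [← coe_im, ← coe_im, coe_J_smul]; simp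
    refine Isometry.of_dist_eq fun z w => ?_
    change dist (J • z) (J • w) = dist z w
    rw [UpperHalfPlane.dist_eq, UpperHalfPlane.dist_eq, him, him, coe_J_smul, coe_J_smul,
      dist_neg_neg, Complex.dist_conj_conj]

lemma coe_imaginaryReflection (z : ℍ) :
    (imaginaryReflection z : ℂ) = -(starRingEnd ℂ) z := coe_J_smul z

lemma imaginaryReflection_mul_self : imaginaryReflection * imaginaryReflection = 1 := by
  apply IsometryEquiv.ext
  intro z
  apply UpperHalfPlane.ext
  rw [IsometryEquiv.mul_apply, coe_imaginaryReflection, coe_imaginaryReflection]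
  simp

lemma imaginaryReflection_imaginaryAxis (s : ℝ) :
    imaginaryReflection (imaginaryAxis s) = imaginaryAxis s := by
  apply UpperHalfPlane.ext
  rw [coe_imaginaryReflection, coe_imaginaryAxis, map_mul, Complex.conj_ofReal, Complex.conj_I]
  ring

lemma imaginaryReflection_smul_flow (s : ℝ) :
    imaginaryReflection • flow s imaginaryAxis = flow s imaginaryAxis :=
  UnitVector.ext fun _ => imaginaryReflection_imaginaryAxis _

lemma imaginaryReflection_notMem_range : imaginaryReflection ∉ mobius.range := by
  rintro ⟨m, hm⟩
  have h1 : mobius m • imaginaryAxis = imaginaryAxis := by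
    rw [hm]
    exact UnitVector.ext fun _ => imaginaryReflection_imaginaryAxis _
  have h2 := mobius_eq_one_of_smul_eq h1
  rw [hm] at h2
  have h3 := coe_imaginaryReflection ⟨1 + Complex.I, by simp⟩
  rw [h2] at h3
  have h4 := congrArg Complex.re h3
  norm_num at h4

/-- The matrix of the conjugate of a Möbius transformation by the reflection in the imaginary
axis. -/
def reflectMatrix (m : SL(2, ℝ)) : SL(2, ℝ) :=
  ⟨!![m 0 0, -m 0 1; -m 1 0, m 1 1], by
    rw [Matrix.det_fin_two_of]; linarith [SL2_det_eq_one m]⟩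

lemma imaginaryReflection_conj_mobius (m : SL(2, ℝ)) :
    imaginaryReflection * mobius m * imaginaryReflection = mobius (reflectMatrix m) := by
  apply IsometryEquiv.ext
  intro z
  apply UpperHalfPlane.ext
  rw [IsometryEquiv.mul_apply, IsometryEquiv.mul_apply, coe_imaginaryReflection, coe_mobius,
    coe_mobius, coe_imaginaryReflection, map_div₀, ← neg_div]
  simp [reflectMatrix]
  ring_nf

lemma dir_imaginaryReflection_smul (v : UnitVector) :
    (imaginaryReflection • v).dir = -(starRingEnd ℂ) v.dir := by
  have h := (hasDerivAt_dir v).star.neg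
  apply HasDerivAt.deriv
  convert! h using 1
  ext u
  exact coe_imaginaryReflection _

lemma eq_imaginaryReflection_smul {s : ℝ} {v w : UnitVector}
    (h : IsReflection (flow s imaginaryAxis) v w) : w = imaginaryReflection • v := by
  obtain ⟨h1, h2, h3⟩ := h
  have hd := dir_imaginaryReflection_smul (flow s imaginaryAxis)
  rw [imaginaryReflection_smul_flow] at hd
  have hne := dir_ne_zero (flow s imaginaryAxis)
  apply UnitVector.ext_of_dir
  · rw [h2]
    change _ = imaginaryReflection v.foot
    rw [h1]
    exact (imaginaryReflection_imaginaryAxis _).symm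
  -- The reflection fixes the axis, so the direction of the axis is purely imaginary.
  · have hd' : (starRingEnd ℂ) (flow s imaginaryAxis).dir = -(flow s imaginaryAxis).dir := by
      linear_combination hd
    rw [map_div₀, hd', div_neg, ← neg_div, div_left_inj' hne] at h3
    rw [h3, dir_imaginaryReflection_smul]

lemma isReflection_mobius_smul {τ v w : UnitVector} (h : IsReflection τ v w) (m : SL(2, ℝ)) :
    IsReflection (mobius m • τ) (mobius m • v) (mobius m • w) := by
  obtain ⟨h1, h2, h3⟩ := h
  refine ⟨congrArg (mobius m) h1, congrArg (mobius m) h2, ?_⟩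
  rw [mobius_smul_dir_div h2, mobius_smul_dir_div h1, h3]

/-- The reflection in the geodesic that is the image of the imaginary axis under `C`. -/
def axisReflection (C : SL(2, ℝ)) : ℍ ≃ᵢ ℍ :=
  mobius C * imaginaryReflection * (mobius C)⁻¹

lemma axisReflection_mul_self (C : SL(2, ℝ)) : axisReflection C * axisReflection C = 1 := by
  have := imaginaryReflection_mul_self
  simp only [axisReflection]
  rw [show ∀ a b : ℍ ≃ᵢ ℍ, a * b * a⁻¹ * (a * b * a⁻¹) = a * (b * b) * a⁻¹ by
    intros; group, this]
  simp

lemma inv_axisReflection (C : SL(2, ℝ)) : (axisReflection C)⁻¹ = axisReflection C :=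
  inv_eq_of_mul_eq_one_left (axisReflection_mul_self C)

lemma axisReflection_mul (n C : SL(2, ℝ)) :
    axisReflection (n * C) = mobius n * axisReflection C * (mobius n)⁻¹ := by
  simp [axisReflection, mul_assoc]

lemma axisReflection_conj_mem_range (C : SL(2, ℝ)) {g : ℍ ≃ᵢ ℍ} (hg : g ∈ mobius.range) :
    axisReflection C * g * axisReflection C ∈ mobius.range := by
  obtain ⟨n, rfl⟩ := hg
  refine ⟨C * reflectMatrix (C⁻¹ * n * C) * C⁻¹, ?_⟩
  rw [map_mul, map_mul, ← imaginaryReflection_conj_mobius, axisReflection]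
  simp only [map_mul, map_inv]
  group

lemma axisReflection_notMem_range (C : SL(2, ℝ)) : axisReflection C ∉ mobius.range := by
  rintro ⟨n, hn⟩
  refine imaginaryReflection_notMem_range ⟨C⁻¹ * n * C, ?_⟩
  rw [map_mul, map_mul, hn, axisReflection, map_inv]
  group

lemma axisReflection_apply (C : SL(2, ℝ)) (s : ℝ) :
    axisReflection C ((mobius C • imaginaryAxis) s) = (mobius C • imaginaryAxis) s := by
  rw [axisReflection, IsometryEquiv.mul_apply, IsometryEquiv.mul_apply, smul_unitVector_apply,
    IsometryEquiv.inv_apply_self, imaginaryReflection_imaginaryAxis]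

lemma eq_axisReflection_smul {C : SL(2, ℝ)} {s : ℝ} {v w : UnitVector}
    (h : IsReflection (mobius C • flow s imaginaryAxis) v w) : w = axisReflection C • v := by
  have h' := isReflection_mobius_smul h C⁻¹
  rw [map_inv, inv_smul_smul] at h'
  have := eq_imaginaryReflection_smul h'
  rw [inv_smul_eq_iff] at this
  rw [this, axisReflection, mul_smul, mul_smul]

/-! ### From microlocal symmetry to a group element. -/

/-- A geodesic that meets another one at two times is tangent to it. -/
lemma sin_eq_zero_of_isAtAngle {c v : UnitVector} {s θ t s' : ℝ} (hv : IsAtAngle c s θ v)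
    (ht : t ≠ 0) (h : v t = c s') : Real.sin θ = 0 := by
  obtain ⟨h0, h1⟩ := hv
  have hd : |0 - t| = |s - s'| := by
    rw [← dist_unitVector v, ← dist_unitVector c, ← h, ← h0, foot_eq]
  have hne := dir_ne_zero (flow s c)
  suffices Complex.exp (θ * Complex.I) = 1 ∨ Complex.exp (θ * Complex.I) = -1 by
    rcases this with e | e
    · simpa [Complex.exp_ofReal_mul_I_im] using congrArg Complex.im e
    · simpa [Complex.exp_ofReal_mul_I_im] using congrArg Complex.im e
  -- Two common points force the geodesics to coincide, traversed in the same direction or in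
  -- opposite ones.
  rcases abs_eq_abs.1 hd with e | e
  · left
    have hvc : v = flow s c := by
      apply UnitVector.ext_of_two_points ht.symm
      · rw [← foot_eq, h0, flow_apply, add_zero]
      · rw [h, flow_apply, show s' = s + t by linarith]
    rw [hvc] at h1
    exact mul_right_cancel₀ hne (by rw [← h1, one_mul])
  · right
    let r : UnitVector := ⟨fun u => flow s c (-u), (flow s c).2.comp (IsometryEquiv.neg ℝ).isometry⟩
    have hvc : v = r := by
      apply UnitVector.ext_of_two_points ht.symm
      · change _ = flow s c (-0)
        rw [← foot_eq, h0, flow_apply, neg_zero, add_zero]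
      · change _ = flow s c (-t)
        rw [h, flow_apply, show s' = s + -t by linarith]
    have hr : r.dir = -(flow s c).dir := by
      have := deriv_comp_neg (fun u : ℝ => ((flow s c u : ℍ) : ℂ)) 0
      rwa [neg_zero] at this
    rw [hvc, hr] at h1
    exact mul_right_cancel₀ hne (by rw [← h1, neg_one_mul])

/-- The density `|sin θ|` vanishes on the tangential vectors. Measurability of the symmetry set
plays no role, since a subset of a null set is null. -/
lemma exists_mem_symmetrySet_sin_ne_zero {Γ : Subgroup (ℍ ≃ᵢ ℍ)} {c : UnitVector} {ℓ : ℝ}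
    (h : HasPositiveMicrolocalSymmetry Γ c ℓ) :
    ∃ p ∈ symmetrySet Γ c, Real.sin p.2 ≠ 0 := by
  by_contra! hc
  have hT : MeasurableSet {p : ℝ × ℝ | Real.sin p.2 = 0} :=
    measurableSet_eq_fun (Real.measurable_sin.comp measurable_snd) measurable_const
  refine h.ne' (measure_mono_null (t := {p : ℝ × ℝ | Real.sin p.2 = 0}) hc ?_)
  rw [liouvilleMeasure, withDensity_apply _ hT, setLIntegral_congr_fun (g := 0) hT]
  · simp
  · intro p hp
    simp only [Set.mem_ofPred_eq] at hp
    simp [hp]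

lemma IsFuchsian.le_range {Γ : Subgroup (ℍ ≃ᵢ ℍ)} (hΓ : IsFuchsian Γ) : Γ ≤ mobius.range := by
  obtain ⟨Γ', -, rfl⟩ := hΓ
  exact Subgroup.map_le_range _ _

/-- Microlocal symmetry at a vector transversal to the closed geodesic yields an element of the
group whose conjugate by the reflection is in the group, and that moves the axis. -/
lemma exists_conj_mem_of_symmetry {Γ : Subgroup (ℍ ≃ᵢ ℍ)} (hΓ : Γ ≤ mobius.range) (C : SL(2, ℝ))
    {p : ℝ × ℝ} (hp : p ∈ symmetrySet Γ (mobius C • imaginaryAxis)) (hsin : Real.sin p.2 ≠ 0) :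
    ∃ σ ∈ Γ, axisReflection C * σ * axisReflection C ∈ Γ ∧
      ∃ u, ∀ s, σ ((mobius C • imaginaryAxis) u) ≠ (mobius C • imaginaryAxis) s := by
  simp only [symmetrySet, Set.mem_iUnion, Set.mem_ofPred_eq] at hp
  obtain ⟨j, v, hv, t, ht, w, hw, σ, hσ, u, f, hf, hproj⟩ := hp
  have ht0 : t ≠ 0 := by
    rcases ht.2 with h | h
    · exact h.2.1.ne'
    · exact h.2.1.ne
  obtain ⟨⟨δ, hδ⟩, hδf⟩ : ∃ δ : Γ, δ • flow t w = f := Quotient.exact hproj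
  replace hδf : δ • flow t w = f := hδf
  refine ⟨σ, hσ, ?_, u, fun s hs => hsin ?_⟩
  · obtain ⟨S, rfl⟩ := hΓ hσ
    have hwv := eq_axisReflection_smul (C := C) hw
    have hff := eq_axisReflection_smul (C := S * C) (s := u) (v := flow t v) (w := f)
      (by rw [map_mul, mul_smul]; exact hf)
    rw [axisReflection_mul, ← hδf, hwv, ← smul_flow, ← mul_smul] at hff
    set ε := axisReflection C
    have hinv : ε⁻¹ = ε := inv_axisReflection C
    -- This quotient contains two reflections, so it preserves orientation; it also fixes `flow t
    -- v`, hence is trivial.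
    have hmem : (mobius S * ε * (mobius S)⁻¹)⁻¹ * (δ * ε) ∈ mobius.range := by
      have : (mobius S * ε * (mobius S)⁻¹)⁻¹ * (δ * ε) =
          mobius S * (ε * ((mobius S)⁻¹ * δ) * ε) := by
        simp only [mul_inv_rev, inv_inv, hinv, mul_assoc]
      rw [this]
      exact mul_mem ⟨S, rfl⟩ (axisReflection_conj_mem_range C
        (mul_mem (inv_mem ⟨S, rfl⟩) (hΓ hδ)))
    obtain ⟨k, hk⟩ := hmem
    have hk1 : mobius k = 1 := by
      apply mobius_eq_one_of_smul_eq (v := flow t v)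
      rw [hk, mul_smul, hff, inv_smul_smul]
    rw [hk1, eq_comm, inv_mul_eq_one] at hk
    have : ε * mobius S * ε = δ⁻¹ * mobius S := by
      have h2 : mobius S * ε = δ * ε * mobius S := mul_inv_eq_iff_eq_mul.1 hk
      calc ε * mobius S * ε = δ⁻¹ * (δ * ε * mobius S) * ε := by group
        _ = δ⁻¹ * mobius S * (ε * ε) := by rw [← h2]; group
        _ = δ⁻¹ * mobius S := by rw [axisReflection_mul_self, mul_one]
    rw [this]
    exact mul_mem (inv_mem hδ) hσ
  -- If `σ (c u)` were on `c`, the geodesic of `v` would meet `c` at times `0` and `t ≠ 0`.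
  · apply sin_eq_zero_of_isAtAngle hv ht0 (s' := s)
    rw [← hs]
    have := hf.1
    simpa [foot_eq, flow_apply, smul_unitVector_apply] using this

/-! ### Discreteness and the end points of the axis. -/

lemma SL2_inv_apply (m : SL(2, ℝ)) :
    m⁻¹ 0 0 = m 1 1 ∧ m⁻¹ 0 1 = -m 0 1 ∧ m⁻¹ 1 0 = -m 1 0 ∧ m⁻¹ 1 1 = m 0 0 := by
  simp [Matrix.SpecialLinearGroup.coe_inv, Matrix.adjugate_fin_two]

lemma SL2_mul_apply (m n : SL(2, ℝ)) (i j : Fin 2) :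
    (m * n) i j = m i 0 * n 0 j + m i 1 * n 1 j := by
  rw [Matrix.SpecialLinearGroup.coe_mul, Matrix.mul_apply, Fin.sum_univ_two]

lemma SL2_ext {m n : SL(2, ℝ)} (h00 : m 0 0 = n 0 0) (h01 : m 0 1 = n 0 1)
    (h10 : m 1 0 = n 1 0) (h11 : m 1 1 = n 1 1) : m = n := by
  ext i j
  fin_cases i <;> fin_cases j <;> assumption

/-- The upper unipotent matrix. -/
def upperUnipotent (x : ℝ) : SL(2, ℝ) := ⟨!![1, x; 0, 1], by simp⟩

/-- The lower unipotent matrix. -/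
def lowerUnipotent (x : ℝ) : SL(2, ℝ) := ⟨!![1, 0; x, 1], by simp⟩

lemma continuous_upperUnipotent : Continuous upperUnipotent := by
  refine continuous_induced_rng.2 (continuous_matrix fun i j => ?_)
  fin_cases i <;> fin_cases j <;> simp <;> fun_prop

lemma continuous_lowerUnipotent : Continuous lowerUnipotent := by
  refine continuous_induced_rng.2 (continuous_matrix fun i j => ?_)
  fin_cases i <;> fin_cases j <;> simp <;> fun_prop

lemma upperUnipotent_zero : upperUnipotent 0 = 1 := by
  apply SL2_ext <;> simp [upperUnipotent]

lemma lowerUnipotent_zero : lowerUnipotent 0 = 1 := by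
  apply SL2_ext <;> simp [lowerUnipotent]

/-- No sequence of nontrivial elements of the group tends to the identity. -/
def SequentiallyDiscrete (Δ : Subgroup SL(2, ℝ)) : Prop :=
  ∀ x : ℕ → SL(2, ℝ), (∀ n, x n ∈ Δ) → Tendsto x atTop (𝓝 1) → ∃ n, x n = 1

lemma sequentiallyDiscrete_of_discreteTopology (Δ : Subgroup SL(2, ℝ)) [DiscreteTopology Δ] :
    SequentiallyDiscrete Δ := by
  intro x hx hlim
  have h : Tendsto (fun n => (⟨x n, hx n⟩ : Δ)) atTop (𝓝 1) := tendsto_subtype_rng.2 hlim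
  rw [nhds_discrete, tendsto_pure] at h
  obtain ⟨n, hn⟩ := h.exists
  exact ⟨n, congrArg Subtype.val hn⟩

lemma SequentiallyDiscrete.map_conj {Δ : Subgroup SL(2, ℝ)} (h : SequentiallyDiscrete Δ)
    (C : SL(2, ℝ)) : SequentiallyDiscrete (Δ.map (MulAut.conj C).toMonoidHom) := by
  intro x hx hlim
  obtain ⟨n, hn⟩ := h (fun n => C⁻¹ * x n * C) (fun n => by
      obtain ⟨y, hy, hxy⟩ := hx n
      rw [← hxy]
      simpa [MulAut.conj_apply, mul_assoc] using hy) (by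
      have := (hlim.const_mul C⁻¹).mul_const C
      simpa using this)
  refine ⟨n, ?_⟩
  rw [mul_assoc, inv_mul_eq_one] at hn
  simpa using hn.symm

section

variable {Δ : Subgroup SL(2, ℝ)} {G S : SL(2, ℝ)}

lemma tendsto_contraction {r : ℝ} (hr : |r| < 1) (x : ℝ) :
    Tendsto (fun n : ℕ => (r ^ 2) ^ n * x) atTop (𝓝 0) := by
  have h1 : |r ^ 2| < 1 := by rw [abs_pow]; exact pow_lt_one₀ (abs_nonneg r) hr two_ne_zero
  simpa using (tendsto_pow_atTop_nhds_zero_of_abs_lt_one h1).mul_const x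

lemma abs_apply_one_one_lt_one (hG01 : G 0 1 = 0) (hG : 1 < |G 0 0|) : |G 1 1| < 1 := by
  have h := SL2_det_eq_one G
  rw [hG01, zero_mul, sub_zero] at h
  have h' : |G 0 0| * |G 1 1| = 1 := by rw [← abs_mul, h, abs_one]
  nlinarith [abs_nonneg (G 1 1)]

/-- Conjugation by `G⁻¹` multiplies `x` by `(G 1 1)² < 1`, so iterated conjugates tend to `1` inside
the discrete group. -/
lemma SequentiallyDiscrete.upperUnipotent_eq_zero (hΔ : SequentiallyDiscrete Δ) (hGΔ : G ∈ Δ)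
    (hG01 : G 0 1 = 0) (hG10 : G 1 0 = 0) (hG : 1 < |G 0 0|) {x : ℝ}
    (hx : upperUnipotent x ∈ Δ) : x = 0 := by
  have hdet := SL2_det_eq_one G
  obtain ⟨i00, i01, i10, i11⟩ := SL2_inv_apply G
  have hlt := abs_apply_one_one_lt_one hG01 hG
  have hmem : ∀ n : ℕ, upperUnipotent (((G 1 1) ^ 2) ^ n * x) ∈ Δ := by
    intro n
    induction n with
    | zero => simpa using hx
    | succ n ih =>
      have : upperUnipotent (((G 1 1) ^ 2) ^ (n + 1) * x) =
          G⁻¹ * upperUnipotent (((G 1 1) ^ 2) ^ n * x) * G := by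
        apply SL2_ext <;> simp only [SL2_mul_apply, i00, i01, i10, i11, hG01, hG10] <;>
          simp [upperUnipotent] <;> grind
      rw [this]
      exact mul_mem (mul_mem (inv_mem hGΔ) ih) hGΔ
  have hlim : Tendsto (fun n : ℕ => upperUnipotent (((G 1 1) ^ 2) ^ n * x)) atTop (𝓝 1) := by
    rw [← upperUnipotent_zero]
    exact (continuous_upperUnipotent.tendsto 0).comp (tendsto_contraction hlt x)
  obtain ⟨n, hn⟩ := hΔ _ hmem hlim
  have h0 : ((G 1 1) ^ 2) ^ n * x = 0 := by
    have := congrArg (fun m : SL(2, ℝ) => m 0 1) hn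
    simpa [upperUnipotent] using this
  rcases mul_eq_zero.1 h0 with h | h
  · have : G 1 1 = 0 := by
      by_contra hne
      exact pow_ne_zero n (pow_ne_zero 2 hne) h
    rw [this, hG01] at hdet
    norm_num at hdet
  · exact h

lemma SequentiallyDiscrete.lowerUnipotent_eq_zero (hΔ : SequentiallyDiscrete Δ) (hGΔ : G ∈ Δ)
    (hG01 : G 0 1 = 0) (hG10 : G 1 0 = 0) (hG : 1 < |G 0 0|) {x : ℝ}
    (hx : lowerUnipotent x ∈ Δ) : x = 0 := by
  have hdet := SL2_det_eq_one G
  obtain ⟨i00, i01, i10, i11⟩ := SL2_inv_apply G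
  have hlt := abs_apply_one_one_lt_one hG01 hG
  have hmem : ∀ n : ℕ, lowerUnipotent (((G 1 1) ^ 2) ^ n * x) ∈ Δ := by
    intro n
    induction n with
    | zero => simpa using hx
    | succ n ih =>
      have : lowerUnipotent (((G 1 1) ^ 2) ^ (n + 1) * x) =
          G * lowerUnipotent (((G 1 1) ^ 2) ^ n * x) * G⁻¹ := by
        apply SL2_ext <;> simp only [SL2_mul_apply, i00, i01, i10, i11, hG01, hG10] <;>
          simp [lowerUnipotent] <;> grind
      rw [this]
      exact mul_mem (mul_mem hGΔ ih) (inv_mem hGΔ)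
  have hlim : Tendsto (fun n : ℕ => lowerUnipotent (((G 1 1) ^ 2) ^ n * x)) atTop (𝓝 1) := by
    rw [← lowerUnipotent_zero]
    exact (continuous_lowerUnipotent.tendsto 0).comp (tendsto_contraction hlt x)
  obtain ⟨n, hn⟩ := hΔ _ hmem hlim
  have h0 : ((G 1 1) ^ 2) ^ n * x = 0 := by
    have := congrArg (fun m : SL(2, ℝ) => m 1 0) hn
    simpa [lowerUnipotent] using this
  rcases mul_eq_zero.1 h0 with h | h
  · have : G 1 1 = 0 := by
      by_contra hne
      exact pow_ne_zero n (pow_ne_zero 2 hne) h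
    rw [this, hG01] at hdet
    norm_num at hdet
  · exact h

lemma sq_apply_ne_one (hG01 : G 0 1 = 0) (hG : 1 < |G 0 0|) : G 0 0 ^ 2 ≠ 1 ∧ G 1 1 ^ 2 ≠ 1 := by
  have hlt := abs_apply_one_one_lt_one hG01 hG
  rw [← sq_abs, ← sq_abs (G 1 1)]
  exact ⟨(one_lt_pow₀ hG two_ne_zero).ne', (pow_lt_one₀ (abs_nonneg _) hlt two_ne_zero).ne⟩

/-- In a discrete group with a hyperbolic element fixing `∞` and `0`, an element fixing `∞` fixes
`0`. -/
lemma SequentiallyDiscrete.apply_zero_one_eq_zero (hΔ : SequentiallyDiscrete Δ) (hGΔ : G ∈ Δ)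
    (hG01 : G 0 1 = 0) (hG10 : G 1 0 = 0) (hG : 1 < |G 0 0|) (hS : S ∈ Δ) (h : S 1 0 = 0) :
    S 0 1 = 0 := by
  have hdetG := SL2_det_eq_one G
  have hdet := SL2_det_eq_one S
  obtain ⟨i00, i01, i10, i11⟩ := SL2_inv_apply G
  obtain ⟨j00, j01, j10, j11⟩ := SL2_inv_apply S
  rw [hG01, zero_mul, sub_zero] at hdetG
  rw [h, mul_zero, sub_zero] at hdet
  -- A commutator of two elements fixing `∞` is a translation, which discreteness forces to be
  -- trivial.
  have hz : S * G * S⁻¹ * G⁻¹ = upperUnipotent (S 0 0 * S 0 1 * (1 - G 0 0 ^ 2)) := by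
    apply SL2_ext <;>
      simp only [SL2_mul_apply, i00, i01, i10, i11, j00, j01, j10, j11, hG01, hG10, h] <;>
      simp [upperUnipotent] <;> grind
  have h0 := hΔ.upperUnipotent_eq_zero hGΔ hG01 hG10 hG
    (hz ▸ mul_mem (mul_mem (mul_mem hS hGΔ) (inv_mem hS)) (inv_mem hGΔ))
  have hne := (sq_apply_ne_one hG01 hG).1
  grind

/-- In a discrete group with a hyperbolic element fixing `∞` and `0`, an element fixing `0` fixes
`∞`. -/
lemma SequentiallyDiscrete.apply_one_zero_eq_zero (hΔ : SequentiallyDiscrete Δ) (hGΔ : G ∈ Δ)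
    (hG01 : G 0 1 = 0) (hG10 : G 1 0 = 0) (hG : 1 < |G 0 0|) (hS : S ∈ Δ) (h : S 0 1 = 0) :
    S 1 0 = 0 := by
  have hdetG := SL2_det_eq_one G
  have hdet := SL2_det_eq_one S
  obtain ⟨i00, i01, i10, i11⟩ := SL2_inv_apply G
  obtain ⟨j00, j01, j10, j11⟩ := SL2_inv_apply S
  rw [hG01, zero_mul, sub_zero] at hdetG
  rw [h, zero_mul, sub_zero] at hdet
  have hz : S * G * S⁻¹ * G⁻¹ = lowerUnipotent (S 1 0 * S 1 1 * (1 - G 1 1 ^ 2)) := by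
    apply SL2_ext <;>
      simp only [SL2_mul_apply, i00, i01, i10, i11, j00, j01, j10, j11, hG01, hG10, h] <;>
      simp [lowerUnipotent] <;> grind
  have h0 := hΔ.lowerUnipotent_eq_zero hGΔ hG01 hG10 hG
    (hz ▸ mul_mem (mul_mem (mul_mem hS hGΔ) (inv_mem hS)) (inv_mem hGΔ))
  have hne := (sq_apply_ne_one hG01 hG).2
  grind

/-- In a discrete group with a hyperbolic element whose axis is the imaginary axis, an element that
moves the imaginary axis moves its end points off it. -/
lemma SequentiallyDiscrete.apply_ne_zero (hΔ : SequentiallyDiscrete Δ) (hGΔ : G ∈ Δ)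
    (hG01 : G 0 1 = 0) (hG10 : G 1 0 = 0) (hG : 1 < |G 0 0|) (hS : S ∈ Δ) {u : ℝ}
    (hu : ∀ s, mobius S (imaginaryAxis u) ≠ imaginaryAxis s) :
    S 0 0 ≠ 0 ∧ S 0 1 ≠ 0 ∧ S 1 0 ≠ 0 ∧ S 1 1 ≠ 0 := by
  have hdetG := SL2_det_eq_one G
  have hdet := SL2_det_eq_one S
  obtain ⟨j00, j01, j10, j11⟩ := SL2_inv_apply S
  rw [hG01, zero_mul, sub_zero] at hdetG
  have hne := sq_apply_ne_one hG01 hG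
  -- This is the numerator of the real part of `S (i e ^ u)`.
  have hre : S 0 1 * S 1 1 + S 0 0 * S 1 0 * Real.exp u ^ 2 ≠ 0 := by
    intro h
    refine hu (Real.log (mobius S (imaginaryAxis u)).im) ?_
    have hre0 : (mobius S (imaginaryAxis u) : ℂ).re = 0 := by
      rw [coe_mobius, coe_imaginaryAxis, Complex.div_re, ← add_div]
      refine div_eq_zero_iff.2 (Or.inl ?_)
      simp [-Complex.ofReal_exp]
      linear_combination h
    apply UpperHalfPlane.ext
    rw [coe_imaginaryAxis, Real.exp_log (UpperHalfPlane.im_pos _)]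
    apply Complex.ext
    · simpa using hre0
    · simp
  have h10 : S 1 0 ≠ 0 := fun h => by
    have := hΔ.apply_zero_one_eq_zero hGΔ hG01 hG10 hG hS h
    simp [h, this] at hre
  have h01 : S 0 1 ≠ 0 := fun h => by
    have := hΔ.apply_one_zero_eq_zero hGΔ hG01 hG10 hG hS h
    simp [h, this] at hre
  refine ⟨fun h => ?_, h01, h10, fun h => ?_⟩
  -- Here `S ∞ = 0`, so `S G S⁻¹` fixes `0` and hence `∞`. This forces `S 1 1 = 0`: `S` would swap
  -- the ends and preserve the axis. The last case is the same for `S⁻¹ G S`.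
  · have h1 := hΔ.apply_one_zero_eq_zero hGΔ hG01 hG10 hG
      (mul_mem (mul_mem hS hGΔ) (inv_mem hS))
      (by simp only [SL2_mul_apply, j01, j11, hG01, hG10, h]; ring)
    simp only [SL2_mul_apply, j00, j10, hG01, hG10] at h1
    grind
  · have h1 := hΔ.apply_one_zero_eq_zero hGΔ hG01 hG10 hG
      (mul_mem (mul_mem (inv_mem hS) hGΔ) hS)
      (by simp only [SL2_mul_apply, j00, j01, hG01, hG10, h]; ring)
    simp only [SL2_mul_apply, j10, j11, hG01, hG10] at h1
    grind

end

/-! ### Dilations and ping-pong. -/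

/-- The matrix of `z ↦ e ^ ℓ z`. -/
def dilation (ℓ : ℝ) : SL(2, ℝ) :=
  ⟨!![Real.exp (ℓ / 2), 0; 0, Real.exp (-(ℓ / 2))], by
    rw [Matrix.det_fin_two_of, ← Real.exp_add]; simp⟩

lemma coe_mobius_dilation (ℓ : ℝ) (z : ℍ) :
    (mobius (dilation ℓ) z : ℂ) = (Real.exp ℓ : ℂ) * z := by
  rw [coe_mobius]
  have h : Real.exp ℓ = Real.exp (ℓ / 2) * Real.exp (ℓ / 2) := by rw [← Real.exp_add]; ring_nf
  have hne : (Real.exp (ℓ / 2) : ℂ) ≠ 0 := by exact_mod_cast (Real.exp_pos _).ne'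
  simp only [dilation, h, Real.exp_neg]
  simp [-Complex.ofReal_exp]
  field_simp

lemma coe_mobius_dilation_pow (ℓ : ℝ) (n : ℕ) (z : ℍ) :
    (mobius (dilation ℓ ^ n) z : ℂ) = (Real.exp ℓ : ℂ) ^ n * z := by
  induction n with
  | zero => simp
  | succ n ih =>
    rw [pow_succ', map_mul, IsometryEquiv.mul_apply, coe_mobius_dilation, ih, pow_succ', mul_assoc]

lemma norm_mobius_dilation (ℓ : ℝ) (z : ℍ) :
    ‖(mobius (dilation ℓ) z : ℂ)‖ = Real.exp ℓ * ‖(z : ℂ)‖ := by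
  rw [coe_mobius_dilation, norm_mul, Complex.norm_real, Real.norm_of_nonneg (Real.exp_pos _).le]

lemma mobius_dilation_smul_imaginaryAxis (ℓ : ℝ) :
    mobius (dilation ℓ) • imaginaryAxis = flow ℓ imaginaryAxis := by
  apply UnitVector.ext
  intro u
  apply UpperHalfPlane.ext
  rw [smul_unitVector_apply, coe_mobius_dilation, flow_apply, coe_imaginaryAxis, coe_imaginaryAxis,
    Real.exp_add]
  push_cast
  ring

/-- Away from `S⁻¹ 0`, a Möbius transformation `S` stays away from `0`. -/
lemma exists_le_norm_mobius (S : SL(2, ℝ)) (h00 : S 0 0 ≠ 0) (h10 : S 1 0 ≠ 0) {η : ℝ}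
    (hη : 0 < η) : ∃ ρ > 0, ∀ z : ℍ, η ≤ ‖(z : ℂ) - ((-S 0 1 / S 0 0 : ℝ) : ℂ)‖ →
      ρ ≤ ‖(mobius S z : ℂ)‖ := by
  have ha : 0 < |S 0 0| := abs_pos.2 h00
  have hc : 0 < |S 1 0| := abs_pos.2 h10
  -- With `a = S 0 0`, `c = S 1 0`, one has `S z = a (a - c S z) (z - S⁻¹ 0)`. Below the first bound
  -- the middle factor is at least `|a| / 2`, which contradicts the second.
  refine ⟨min (|S 0 0| / (2 * |S 1 0|)) (η * |S 0 0| ^ 2 / 2), by positivity, fun z hz => ?_⟩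
  by_contra! hlt
  obtain ⟨h1, h2⟩ := lt_min_iff.1 hlt
  have hdet : (S 0 0 : ℂ) * S 1 1 - S 0 1 * S 1 0 = 1 := by exact_mod_cast SL2_det_eq_one S
  have hid : (-(S 1 0 : ℂ) * (mobius S z : ℂ) + S 0 0) *
      ((z : ℂ) - ((-S 0 1 / S 0 0 : ℝ) : ℂ)) * S 0 0 = (mobius S z : ℂ) := by
    have hden := mobius_denom_ne_zero S z
    have h00' : (S 0 0 : ℂ) ≠ 0 := by exact_mod_cast h00
    rw [coe_mobius]
    push_cast
    field_simp
    linear_combination (S 0 0 * z + S 0 1 : ℂ) * hdet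
  have h3 : |S 0 0| / 2 ≤ ‖-(S 1 0 : ℂ) * (mobius S z : ℂ) + S 0 0‖ := by
    have h4 := norm_sub_le_norm_add (S 0 0 : ℂ) (-(S 1 0 : ℂ) * (mobius S z : ℂ))
    rw [add_comm] at h4
    rw [norm_mul, norm_neg, Complex.norm_real, Complex.norm_real, Real.norm_eq_abs,
      Real.norm_eq_abs] at h4
    rw [lt_div_iff₀ (by positivity)] at h1
    nlinarith
  have h5 := congrArg norm hid
  rw [norm_mul, norm_mul, Complex.norm_real, Real.norm_eq_abs] at h5
  have h6 : |S 0 0| / 2 * η * |S 0 0| ≤ ‖(mobius S z : ℂ)‖ := by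
    rw [← h5]; gcongr
  nlinarith

/-- Far from `0`, a Möbius transformation `S` is close to `S ∞`. -/
lemma exists_norm_mobius_sub_lt (S : SL(2, ℝ)) (h10 : S 1 0 ≠ 0) {δ : ℝ} (hδ : 0 < δ) :
    ∃ R, ∀ z : ℍ, R ≤ ‖(z : ℂ)‖ → ‖(mobius S z : ℂ) - ((S 0 0 / S 1 0 : ℝ) : ℂ)‖ < δ := by
  have hc : 0 < |S 1 0| := abs_pos.2 h10
  -- Chosen to make `|c z + d| > 1 / (|c| δ)`, because `S z - S ∞ = -1 / (c (c z + d))`.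
  refine ⟨(1 / (|S 1 0| * δ) + |S 1 1| + 1) / |S 1 0|, fun z hz => ?_⟩
  have hdet : (S 0 0 : ℂ) * S 1 1 - S 0 1 * S 1 0 = 1 := by exact_mod_cast SL2_det_eq_one S
  have hden := mobius_denom_ne_zero S z
  have hid : (mobius S z : ℂ) - ((S 0 0 / S 1 0 : ℝ) : ℂ) =
      -1 / (S 1 0 * ((S 1 0 : ℂ) * z + S 1 1)) := by
    have h10' : (S 1 0 : ℂ) ≠ 0 := by exact_mod_cast h10
    rw [coe_mobius]
    push_cast
    rw [div_sub_div _ _ hden h10', div_eq_div_iff (mul_ne_zero hden h10') (mul_ne_zero h10' hden)]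
    linear_combination (-(S 1 0 * (S 1 0 * z + S 1 1)) : ℂ) * hdet
  have h4 := norm_sub_le_norm_add ((S 1 0 : ℂ) * z) (S 1 1 : ℂ)
  rw [norm_mul, Complex.norm_real, Complex.norm_real, Real.norm_eq_abs, Real.norm_eq_abs] at h4
  rw [div_le_iff₀ hc] at hz
  have h5 : 1 / (|S 1 0| * δ) < ‖(S 1 0 : ℂ) * z + S 1 1‖ := by nlinarith
  rw [hid, norm_div, norm_neg, norm_one, norm_mul, Complex.norm_real, Real.norm_eq_abs]
  rw [div_lt_iff₀ (by positivity)] at h5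
  rw [div_lt_iff₀ (mul_pos hc (norm_pos_iff.2 hden))]
  linarith

/-- For large `N`, the transformation `S D ^ N S`, where `D` is a dilation, maps the points away
from `S⁻¹ 0` to points close to `S ∞`. -/
lemma exists_norm_mobius_mul_pow_mul_sub_lt (S : SL(2, ℝ)) (h00 : S 0 0 ≠ 0) (h10 : S 1 0 ≠ 0)
    {ℓ η δ : ℝ} (hℓ : 0 < ℓ) (hη : 0 < η) (hδ : 0 < δ) :
    ∃ N : ℕ, ∀ z : ℍ, η ≤ ‖(z : ℂ) - ((-S 0 1 / S 0 0 : ℝ) : ℂ)‖ →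
      ‖(mobius (S * dilation ℓ ^ N * S) z : ℂ) - ((S 0 0 / S 1 0 : ℝ) : ℂ)‖ < δ := by
  obtain ⟨ρ, hρ, h1⟩ := exists_le_norm_mobius S h00 h10 hη
  obtain ⟨R, h2⟩ := exists_norm_mobius_sub_lt S h10 hδ
  obtain ⟨N, hN⟩ := pow_unbounded_of_one_lt (R / ρ) (Real.one_lt_exp_iff.2 hℓ)
  refine ⟨N, fun z hz => ?_⟩
  rw [map_mul, map_mul, IsometryEquiv.mul_apply, IsometryEquiv.mul_apply]
  apply h2
  rw [coe_mobius_dilation_pow, norm_mul, norm_pow, Complex.norm_real,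
    Real.norm_of_nonneg (Real.exp_pos _).le]
  rw [div_lt_iff₀ hρ] at hN
  exact hN.le.trans (by gcongr; exact h1 z hz)

/-- Conjugates of a dilation by isometries `φ i` generate a free group when the complements of
the annuli `φ i ⁻¹ {r i / μ < |z| < r i * μ}`, `μ = e ^ (ℓ / 2)`, are pairwise disjoint. -/
lemma injective_lift_conj_dilation {ι : Type} [Nontrivial ι] {ℓ : ℝ} (hℓ : 0 < ℓ)
    (φ : ι → (ℍ ≃ᵢ ℍ)) (r : ι → ℝ) (hr : ∀ i, 0 < r i) (W : ι → Set ℍ)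
    (hW : Pairwise fun i j => Disjoint (W i) (W j))
    (hφ : ∀ i z, r i * Real.exp (ℓ / 2) ≤ ‖(φ i z : ℂ)‖ ∨ ‖(φ i z : ℂ)‖ ≤ r i / Real.exp (ℓ / 2) →
      z ∈ W i) :
    Function.Injective
      (FreeGroup.lift fun i => (φ i)⁻¹ * mobius (dilation ℓ) * φ i) := by
  let _ : MulAction (ℍ ≃ᵢ ℍ) ℍ :=
    { smul := fun g z => g z, one_smul := fun _ => rfl, mul_smul := fun _ _ _ => rfl }
  have hμ := Real.exp_pos (ℓ / 2)
  have hμ1 : 1 < Real.exp (ℓ / 2) := Real.one_lt_exp_iff.2 (by linarith)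
  have hexp : Real.exp ℓ = Real.exp (ℓ / 2) * Real.exp (ℓ / 2) := by rw [← Real.exp_add]; ring_nf
  generalize Real.exp (ℓ / 2) = μ at *
  -- `X i` attracts under the `i`-th generator and `Y i` under its inverse: the dilation by `μ²`
  -- carries the inner circle of the annulus to the outer one.
  let X : ι → Set ℍ := fun i => {z | r i * μ ≤ ‖(φ i z : ℂ)‖}
  let Y : ι → Set ℍ := fun i => {z | ‖(φ i z : ℂ)‖ ≤ r i / μ}
  have hXW : ∀ i, X i ⊆ W i := fun i z hz => hφ i z (Or.inl hz)
  have hYW : ∀ i, Y i ⊆ W i := fun i z hz => hφ i z (Or.inr hz)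
  refine FreeGroup.injective_lift_of_ping_pong _ X Y ?_ ?_ ?_ ?_ ?_ ?_
  · intro i
    have hpos : 0 < r i * μ := mul_pos (hr i) hμ
    refine ⟨(φ i)⁻¹ (imaginaryAxis (Real.log (r i * μ))), ?_⟩
    change r i * μ ≤ ‖(φ i ((φ i)⁻¹ _) : ℂ)‖
    rw [IsometryEquiv.apply_inv_self, coe_imaginaryAxis, Real.exp_log hpos, norm_mul,
      Complex.norm_real, Complex.norm_I, mul_one]
    exact le_abs_self _
  · exact fun i j hij => (hW hij).mono (hXW i) (hXW j)
  · exact fun i j hij => (hW hij).mono (hYW i) (hYW j)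
  · intro i j
    by_cases hij : i = j
    · subst hij
      rw [Set.disjoint_left]
      intro z hX hY
      have h1 : r i * μ ≤ r i / μ := le_trans hX hY
      rw [le_div_iff₀ hμ] at h1
      have := hr i
      nlinarith [mul_pos this hμ]
    · exact (hW hij).mono (hXW i) (hYW j)
  · rintro i _ ⟨z, hz, rfl⟩
    have hz' : r i / μ < ‖(φ i z : ℂ)‖ := not_le.1 hz
    change r i * μ ≤ ‖(φ i ((φ i)⁻¹ (mobius (dilation ℓ) (φ i z))) : ℂ)‖
    rw [IsometryEquiv.apply_inv_self, norm_mobius_dilation, hexp]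
    rw [div_lt_iff₀ hμ] at hz'
    nlinarith
  · rintro i _ ⟨z, hz, rfl⟩
    have hz' : ‖(φ i z : ℂ)‖ < r i * μ := not_le.1 hz
    change ((φ i)⁻¹ * mobius (dilation ℓ) * φ i)⁻¹ z ∈ Y i
    rw [mul_inv_rev, mul_inv_rev, inv_inv]
    change ‖(φ i ((φ i)⁻¹ ((mobius (dilation ℓ))⁻¹ (φ i z))) : ℂ)‖ ≤ r i / μ
    rw [IsometryEquiv.apply_inv_self]
    have h1 := norm_mobius_dilation ℓ ((mobius (dilation ℓ))⁻¹ (φ i z))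
    rw [IsometryEquiv.apply_inv_self, hexp] at h1
    rw [le_div_iff₀ hμ]
    nlinarith

lemma abs_re_sub_le_norm_sub (z : ℂ) (p : ℝ) : |z.re - p| ≤ ‖z - p‖ := by
  simpa using Complex.abs_re_le_norm (z - p)

/-- If all entries of `S` are nonzero, then for some `N` the dilation `D`, its conjugate by
`S D ^ N S`, and the mirror image of the latter in the imaginary axis are free generators. -/
lemma exists_injective_lift_dilation (S : SL(2, ℝ)) (h00 : S 0 0 ≠ 0) (h01 : S 0 1 ≠ 0)
    (h10 : S 1 0 ≠ 0) {ℓ : ℝ} (hℓ : 0 < ℓ) :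
    ∃ N : ℕ, Function.Injective (FreeGroup.lift fun i : Fin 3 =>
      (![1, (mobius (S * dilation ℓ ^ N * S))⁻¹,
        (mobius (S * dilation ℓ ^ N * S))⁻¹ * imaginaryReflection] i)⁻¹ * mobius (dilation ℓ) *
      ![1, (mobius (S * dilation ℓ ^ N * S))⁻¹,
        (mobius (S * dilation ℓ ^ N * S))⁻¹ * imaginaryReflection] i) := by
  have hμ := Real.exp_pos (ℓ / 2)
  have hμ1 : 1 < Real.exp (ℓ / 2) := Real.one_lt_exp_iff.2 (by linarith)
  set p := S 0 0 / S 1 0 with hp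
  set q := -S 0 1 / S 0 0 with hq
  have hp0 : 0 < |p| := abs_pos.2 (div_ne_zero h00 h10)
  have hq0 : 0 < |q| := abs_pos.2 (div_ne_zero (neg_ne_zero.2 h01) h00)
  set μ := Real.exp (ℓ / 2) with hμdef
  have hν : 0 < 1 - 1 / μ := by rw [sub_pos, div_lt_one hμ]; exact hμ1
  -- Hence the disc of radius `|p| (1 - 1 / μ)` about `p` stays inside both circles of the annulus
  -- `|p| / μ < |z| < |p| μ`, and on one side of the imaginary axis.
  have hν2 : 1 - 1 / μ ≤ μ - 1 := by
    have : μ + 1 / μ - 2 = (μ - 1) ^ 2 / μ := by field_simp; ring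
    have : 0 ≤ (μ - 1) ^ 2 / μ := by positivity
    linarith
  obtain ⟨N, hN⟩ := exists_norm_mobius_mul_pow_mul_sub_lt S h00 h10 hℓ
    (mul_pos hq0 hν) (mul_pos hp0 hν)
  refine ⟨N, ?_⟩
  set h := mobius (S * dilation ℓ ^ N * S)
  have hmaps : ∀ z : ℍ, |q| * μ ≤ ‖(z : ℂ)‖ ∨ ‖(z : ℂ)‖ ≤ |q| / μ →
      |p| / μ < ‖(h z : ℂ)‖ ∧ ‖(h z : ℂ)‖ < |p| * μ ∧ 0 < p * (h z).re := by
    intro z hz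
    have hz' : |q| * (1 - 1 / μ) ≤ ‖(z : ℂ) - (q : ℂ)‖ := by
      have e1 := norm_sub_norm_le (z : ℂ) (q : ℂ)
      have e2 := norm_sub_norm_le (q : ℂ) (z : ℂ)
      rw [norm_sub_rev] at e2
      rw [Complex.norm_real, Real.norm_eq_abs] at e1 e2
      rw [mul_sub, mul_one, mul_one_div]
      rcases hz with hz | hz
      · rw [← mul_one_div] at *; nlinarith
      · linarith
    have hd := hN z hz'
    have e1 := norm_sub_norm_le (h z : ℂ) (p : ℂ)
    have e2 := norm_sub_norm_le (p : ℂ) (h z : ℂ)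
    rw [norm_sub_rev] at e2
    rw [Complex.norm_real, Real.norm_eq_abs] at e1 e2
    refine ⟨?_, ?_, ?_⟩
    · rw [← mul_one_div]; nlinarith
    · nlinarith
    · have e3 := (abs_re_sub_le_norm_sub (h z : ℂ) p).trans_lt hd
      have e4 : |(h z : ℂ).re - p| < |p| := e3.trans_le (by
        have : 0 < 1 / μ := by positivity
        nlinarith)
      rw [← sq_lt_sq] at e4
      rw [← coe_re]
      nlinarith [sq_nonneg (h z : ℂ).re]
  have hnorm : ∀ z : ℍ, ‖(imaginaryReflection z : ℂ)‖ = ‖(z : ℂ)‖ := fun z => by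
    rw [coe_imaginaryReflection, norm_neg, Complex.norm_conj]
  have hre : ∀ z : ℍ, (imaginaryReflection z).re = -z.re := fun z => by
    rw [← coe_re, coe_imaginaryReflection]; simp
  -- The ping-pong regions are the complement of the annulus around `|z| = |p|` and the two halves
  -- of that annulus, exchanged by the reflection.
  refine injective_lift_conj_dilation hℓ _ ![|p|, |q|, |q|] ?_
    ![{z | |p| * μ ≤ ‖(z : ℂ)‖ ∨ ‖(z : ℂ)‖ ≤ |p| / μ},
      {z | |p| / μ < ‖(z : ℂ)‖ ∧ ‖(z : ℂ)‖ < |p| * μ ∧ 0 < p * z.re},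
      {z | |p| / μ < ‖(z : ℂ)‖ ∧ ‖(z : ℂ)‖ < |p| * μ ∧ p * z.re < 0}] ?_ ?_
  · intro i
    fin_cases i
    exacts [hp0, hq0, hq0]
  · intro i j hij
    rw [Set.disjoint_left]
    intro z
    fin_cases i <;> fin_cases j <;> simp at hij ⊢ <;> grind
  · intro i z hz
    fin_cases i
    · simpa using hz
    · have := hmaps (h⁻¹ z) hz
      rwa [IsometryEquiv.apply_inv_self] at this
    · have := hmaps (h⁻¹ (imaginaryReflection z)) hz
      rw [IsometryEquiv.apply_inv_self, hnorm, hre, mul_neg, neg_pos] at this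
      exact this

/-! ### Rank of a free group. -/

/-- Send the free generators to the standard basis of `ℚⁿ`: the image of any generating set spans,
so it has at least `n` elements. -/
lemma card_le_card_of_closure_eq_top {n : ℕ} {G : Type*} [Group G] (e : FreeGroup (Fin n) ≃* G)
    (T : Finset G) (hT : Subgroup.closure (T : Set G) = ⊤) : n ≤ T.card := by
  classical
  let f : G →* Multiplicative (Fin n → ℚ) :=
    (FreeGroup.lift fun i => Multiplicative.ofAdd (Pi.single i (1 : ℚ))).comp e.symm.toMonoidHom
  let V : Submodule ℚ (Fin n → ℚ) :=
    Submodule.span ℚ (T.image fun g => (f g).toAdd : Finset (Fin n → ℚ))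
  have hV : ∀ g : G, (f g).toAdd ∈ V := by
    intro g
    have hg : g ∈ Subgroup.closure (T : Set G) := hT ▸ Subgroup.mem_top g
    induction hg using Subgroup.closure_induction with
    | mem x hx => exact Submodule.subset_span (by simpa using ⟨x, hx, rfl⟩)
    | one => simp
    | mul x y _ _ hx hy => rw [map_mul, toAdd_mul]; exact V.add_mem hx hy
    | inv x _ hx => rw [map_inv, toAdd_inv]; exact V.neg_mem hx
  have htop : V = ⊤ := by
    rw [eq_top_iff, ← (Pi.basisFun ℚ (Fin n)).span_eq, Submodule.span_le]
    rintro _ ⟨i, rfl⟩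
    have := hV (e (FreeGroup.of i))
    simpa [f] using this
  calc n = Module.finrank ℚ V := by rw [htop, finrank_top, Module.finrank_fin_fun]
    _ ≤ (T.image fun g => (f g).toAdd).card := finrank_span_finset_le_card _
    _ ≤ T.card := Finset.card_image_le

lemma rank_closure_eq_of_injective_lift {n : ℕ} {G : Type*} [Group G] (a : Fin n → G)
    (ha : Function.Injective (FreeGroup.lift a)) [Group.FG (Subgroup.closure (Set.range a))] :
    Group.rank (Subgroup.closure (Set.range a)) = n := by
  apply le_antisymm
  · refine (Subgroup.rank_closure_finite_le_nat_card (Set.range a)).trans ?_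
    simpa using Finite.card_range_le a
  · have e : FreeGroup (Fin n) ≃* Subgroup.closure (Set.range a) :=
      (MonoidHom.ofInjective ha).trans (MulEquiv.subgroupCongr (FreeGroup.range_lift_eq_closure))
    obtain ⟨T, hT, hcl⟩ := Group.rank_spec (Subgroup.closure (Set.range a))
    rw [← hT]
    exact card_le_card_of_closure_eq_top e T hcl

/-! ### Coordinates adapted to the closed geodesic, and the conclusion. -/

lemma eq_conj_dilation {γ : ℍ ≃ᵢ ℍ} {C : SL(2, ℝ)} {ℓ : ℝ} (hγ : γ ∈ mobius.range)
    (h : ∀ s, γ ((mobius C • imaginaryAxis) s) = (mobius C • imaginaryAxis) (s + ℓ)) :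
    γ = mobius C * mobius (dilation ℓ) * (mobius C)⁻¹ := by
  obtain ⟨g, rfl⟩ := hγ
  have h1 : mobius g • mobius C • imaginaryAxis = mobius (C * dilation ℓ) • imaginaryAxis := by
    rw [map_mul, mul_smul, mobius_dilation_smul_imaginaryAxis]
    apply UnitVector.ext
    intro s
    exact (h s).trans (by rw [add_comm]; rfl)
  have h2 : mobius ((C * dilation ℓ)⁻¹ * (g * C)) = 1 := by
    apply mobius_eq_one_of_smul_eq (v := imaginaryAxis)
    rw [map_mul, map_mul, mul_smul, mul_smul, h1, map_inv, inv_smul_smul]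
  rw [map_mul, map_inv, inv_mul_eq_one, map_mul, map_mul] at h2
  rw [h2, mul_inv_cancel_right]

lemma imaginaryReflection_conj_dilation (ℓ : ℝ) :
    imaginaryReflection * mobius (dilation ℓ) * imaginaryReflection = mobius (dilation ℓ) := by
  rw [imaginaryReflection_conj_mobius]
  congr 1
  apply SL2_ext <;> simp [reflectMatrix, dilation]

lemma axisReflection_conj_conj_dilation (C : SL(2, ℝ)) (ℓ : ℝ) :
    axisReflection C * (mobius C * mobius (dilation ℓ) * (mobius C)⁻¹) * axisReflection C =
      mobius C * mobius (dilation ℓ) * (mobius C)⁻¹ := by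
  conv_rhs => rw [← imaginaryReflection_conj_dilation]
  rw [axisReflection]
  group

/-- The matrix of an element of a Fuchsian group that moves the axis of a hyperbolic element has
nonzero entries in coordinates in which this axis is the imaginary one. -/
lemma IsFuchsian.exists_matrix {Γ : Subgroup (ℍ ≃ᵢ ℍ)} (hΓ : IsFuchsian Γ) {C : SL(2, ℝ)} {ℓ : ℝ}
    (hℓ : 0 < ℓ) (hγ : mobius C * mobius (dilation ℓ) * (mobius C)⁻¹ ∈ Γ) {σ : ℍ ≃ᵢ ℍ}
    (hσ : σ ∈ Γ) {u : ℝ}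
    (hu : ∀ s, σ ((mobius C • imaginaryAxis) u) ≠ (mobius C • imaginaryAxis) s) :
    ∃ S : SL(2, ℝ), σ = mobius (C * S * C⁻¹) ∧ S 0 0 ≠ 0 ∧ S 0 1 ≠ 0 ∧ S 1 0 ≠ 0 := by
  obtain ⟨Γ', hdisc, rfl⟩ := hΓ
  obtain ⟨g, hg, hgγ⟩ := hγ
  obtain ⟨s, hs, rfl⟩ := hσ
  have hΔ := (sequentiallyDiscrete_of_discreteTopology Γ').map_conj C⁻¹
  have hgC : g = C * dilation ℓ * C⁻¹ ∨ g = -(C * dilation ℓ * C⁻¹) := by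
    apply eq_or_eq_neg_of_mobius_eq
    rw [hgγ]
    simp only [map_mul, map_inv]
  -- A lift to `SL(2, ℝ)` is determined only up to sign; this is why the discreteness lemmas assume
  -- `1 < |G 0 0|` with an absolute value.
  have hG : C⁻¹ * g * C = dilation ℓ ∨ C⁻¹ * g * C = -dilation ℓ := by
    rcases hgC with h | h
    · left; rw [h]; group
    · right; rw [h, mul_neg, neg_mul]; congr 1; group
  have hmem : ∀ x ∈ Γ', C⁻¹ * x * C ∈ Γ'.map (MulAut.conj C⁻¹).toMonoidHom :=
    fun x hx => ⟨x, hx, by simp⟩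
  have hexp : 1 < Real.exp (ℓ / 2) := Real.one_lt_exp_iff.2 (by linarith)
  have hdil : dilation ℓ 0 0 = Real.exp (ℓ / 2) ∧ dilation ℓ 0 1 = 0 ∧ dilation ℓ 1 0 = 0 :=
    ⟨rfl, rfl, rfl⟩
  have hne := hΔ.apply_ne_zero (G := C⁻¹ * g * C) (S := C⁻¹ * s * C) (u := u) (hmem g hg)
    (by rcases hG with h | h <;> simp [h, hdil])
    (by rcases hG with h | h <;> simp [h, hdil])
    (by rcases hG with h | h <;> simpa [h, hdil, -Real.one_lt_exp_iff] using hexp)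
    (hmem s hs) (fun t ht => hu t (by
      rw [map_mul, map_mul, map_inv, IsometryEquiv.mul_apply, IsometryEquiv.mul_apply] at ht
      have h := congrArg (mobius C) ht
      rw [IsometryEquiv.apply_inv_self] at h
      exact h))
  exact ⟨C⁻¹ * s * C, by congr 1; group, hne.1, hne.2.1, hne.2.2.1⟩

end HypSurface

end

open HypSurface in
theorem mainTheorem10 (Γ : Subgroup (ℍ ≃ᵢ ℍ)) (hΓ : HypSurface.IsFuchsian Γ)
    (γ : ℍ ≃ᵢ ℍ) (c : HypSurface.UnitVector) (ℓ : ℝ)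
    (hγ : HypSurface.IsClosedGeodesic Γ γ c ℓ)
    (hsymm : HypSurface.HasPositiveMicrolocalSymmetry Γ c ℓ) :
    ∃ ε : ℍ ≃ᵢ ℍ, HypSurface.OrientationReversing ε ∧ ε * ε = 1 ∧
      (∀ s : ℝ, ε (c s) = c s) ∧
      ∃ σ₁ ∈ Γ, ∃ σ₂ ∈ Γ, σ₂ = ε * σ₁ * ε ∧
        Group.rank (Subgroup.closure ({γ, σ₁, σ₂} : Set (ℍ ≃ᵢ ℍ))) = 3 := by
  obtain ⟨p, hp, hsin⟩ := exists_mem_symmetrySet_sin_ne_zero hsymm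
  obtain ⟨C, rfl⟩ := exists_mobius_smul_imaginaryAxis c
  obtain ⟨σ, hσ, hεσ, u, hu⟩ := exists_conj_mem_of_symmetry hΓ.le_range C hp hsin
  have hγC := eq_conj_dilation (hΓ.le_range hγ.mem) hγ.translate
  obtain ⟨S, hS, h00, h01, h10⟩ := hΓ.exists_matrix hγ.length_pos (hγC ▸ hγ.mem) hσ hu
  obtain ⟨N, hN⟩ := exists_injective_lift_dilation S h00 h01 h10 hγ.length_pos
  have hεγ := axisReflection_conj_conj_dilation C ℓ
  rw [← hγC] at hεγ
  have hεε := axisReflection_mul_self C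
  have hinv := inv_axisReflection C
  have hconj : ∀ x, axisReflection C * x * axisReflection C = MulAut.conj (axisReflection C) x :=
    fun x => by rw [MulAut.conj_apply, hinv]
  rw [hconj] at hεσ hεγ
  have hτ : σ * γ ^ N * σ ∈ Γ := mul_mem (mul_mem hσ (pow_mem hγ.mem N)) hσ
  have hετ : MulAut.conj (axisReflection C) (σ * γ ^ N * σ) ∈ Γ := by
    rw [map_mul, map_mul, map_pow, hεγ]
    exact mul_mem (mul_mem hεσ (pow_mem hγ.mem N)) hεσ
  have hτC : σ * γ ^ N * σ =
      mobius C * mobius (S * dilation ℓ ^ N * S) * (mobius C)⁻¹ := by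
    rw [hγC, hS, conj_pow]
    simp only [map_mul, map_inv, map_pow]
    group
  generalize σ * γ ^ N * σ = τ at *
  generalize mobius (S * dilation ℓ ^ N * S) = h at *
  refine ⟨axisReflection C, axisReflection_notMem_range C, hεε, axisReflection_apply C,
    τ * γ * τ⁻¹, mul_mem (mul_mem hτ hγ.mem) (inv_mem hτ),
    axisReflection C * (τ * γ * τ⁻¹) * axisReflection C, ?_, rfl, ?_⟩
  · rw [hconj, map_mul, map_mul, map_inv, hεγ]
    exact mul_mem (mul_mem hετ hγ.mem) (inv_mem hετ)
  · have hinj : Function.Injective (FreeGroup.lift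
        ![γ, τ * γ * τ⁻¹, axisReflection C * (τ * γ * τ⁻¹) * axisReflection C]) := by
      -- Conjugation by `C` carries the free generators found on the imaginary axis to those on the
      -- axis of `γ`.
      have hcomp := (MulAut.conj (mobius C)).injective.comp hN
      rw [← MulEquiv.coe_toMonoidHom, ← MonoidHom.coe_comp] at hcomp
      convert! hcomp using 2
      refine FreeGroup.ext_hom _ _ fun i => ?_
      have h0 : imaginaryReflection⁻¹ = imaginaryReflection :=
        inv_eq_of_mul_eq_one_left imaginaryReflection_mul_self
      fin_cases i
      · simp [hγC]
      · simp [hγC, hτC, mul_assoc]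
      · simp [hγC, hτC, mul_assoc, axisReflection, h0]
    have hrange : ({γ, τ * γ * τ⁻¹, axisReflection C * (τ * γ * τ⁻¹) * axisReflection C} :
        Set (ℍ ≃ᵢ ℍ)) =
        Set.range ![γ, τ * γ * τ⁻¹, axisReflection C * (τ * γ * τ⁻¹) * axisReflection C] := by
      simp only [Matrix.range_cons, Matrix.range_empty, Set.union_empty, Set.singleton_union]
    exact (Subgroup.rank_congr (congrArg Subgroup.closure hrange)).trans
      (rank_closure_eq_of_injective_lift _ hinj)
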